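/- For $\epsilon,\epsilon'\in\mathbb{R}$, $\zeta\in\mathbb{C}$ and $\tau$ in the upper half-plane $\mathbb{H}$, let $$\theta\!\left[{\epsilon\atop\epsilon'}\right](\zeta,\tau)=\sum_{n\in\mathbb{Z}}\exp\left(2\pi i\left[\tfrac12\left(n+\tfrac{\epsilon}{2}\right)^2\tau+\left(n+\tfrac{\epsilon}{2}\right)\left(\zeta+\tfrac{\epsilon'}{2}\right)\right]\right),\qquad \theta'\!\left[{\epsilon\atop\epsilon'}\right](0,\tau)=\left.\frac{\partial}{\partial\zeta}\theta\!\left[{\epsilon\atop\epsilon'}\right](\zeta,\tau)\right|_{\zeta=0},$$ and write $\theta[\epsilon;\epsilon'](\tau)$ for $\theta\!\left[{\epsilon\atop\epsilon'}\right](0,\tau)$ and $\theta'[\epsilon;\epsilon'](\tau)$ for $\theta'\!\left[{\epsilon\atop\epsilon'}\right](0,\tau)$. Put $$D(\tau)=\theta^4[1;\tfrac14](\tau)+\theta^4[1;\tfrac34](\tau),\qquad X(\tau)=\theta^2[1;0](2\tau)\,\theta[0;1](4\tau)\left\{\theta^2[0;0](4\tau)+3\,\theta^2[1;0](4\tau)\right\}.$$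 **Theorem.** The function $D$ does not vanish identically on $\mathbb{H}$. For every $\tau\in\mathbb{H}$ with $D(\tau)\neq0$, $$\theta'[1;\tfrac14](\tau)=\frac{-\pi\,\theta[1;\tfrac14](\tau)\,\theta[0;0](4\tau)}{D(\tau)}\left(X(\tau)+2\sqrt2\,\theta^4[1;\tfrac34](\tau)\,\theta[0;0](2\tau)\right)$$ and $$\theta'[1;\tfrac34](\tau)=\frac{\pi\,\theta[1;\tfrac34](\tau)\,\theta[0;0](4\tau)}{D(\tau)}\left(X(\tau)-2\sqrt2\,\theta^4[1;\tfrac14](\tau)\,\theta[0;0](2\tau)\right).$$ Moreover, both identities multiplied through by $D(\tau)$ hold for every $\tau\in\mathbb{H}$, including the zeros of $D$. -/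

import Mathlib

noncomputable section

/-- The theta function with real characteristics `ε, ε'`:
`θ[ε; ε'](ζ, τ) = ∑_{n ∈ ℤ} exp (2πi (½ (n + ε/2)² τ + (n + ε/2)(ζ + ε'/2)))`,
for `ζ ∈ ℂ` and `τ` in the upper half-plane (where the series converges absolutely). -/
def theta (ε ε' : ℝ) (ζ τ : ℂ) : ℂ :=
  ∑' n : ℤ, Complex.exp (2 * (Real.pi : ℂ) * Complex.I *
    ((1 / 2 : ℂ) * ((n : ℂ) + (ε : ℂ) / 2) ^ 2 * τ +
      ((n : ℂ) + (ε : ℂ) / 2) * (ζ + (ε' : ℂ) / 2)))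

/-- The theta derivative `θ'[ε; ε'](0, τ) = ∂/∂ζ θ[ε; ε'](ζ, τ)` at `ζ = 0`. -/
def thetaDeriv (ε ε' : ℝ) (τ : ℂ) : ℂ :=
  deriv (fun ζ : ℂ => theta ε ε' ζ τ) 0

end

open Complex Filter Topology

/-! Splitting a double theta series by parity expresses a product of two theta values at τ through
values at 2τ; differentiating gives Wronskian-type identities. At the points 3/8 and 1/8 these
determine the difference and the sum of the logarithmic derivatives (`jacobiThetaHalf'_sub_eighths`,
`jacobiThetaHalf'_add_eighths`), so each is θ₃(4τ) times a combination of θ₃(4τ) and √2 θ₃(2τ).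
Multiplying by D and applying one algebraic identity
(`sqrt_two_mul_jacobiThetaHalf_eighths_pow_four_sub`) gives the stated form.

Two inputs do not come from algebra alone: Jacobi's derivative formula and
`jacobiTheta₂_quarter_mul_jacobiThetaHalf_zero`. In both, a quotient of theta values is invariant
under τ ↦ 2τ, hence equals its limit along 2^k τ. The nonvanishing of the denominators uses the same
doubling. -/

/-- The theta function with characteristic `[1; 0]`, written through `jacobiTheta₂`. -/
noncomputable def jacobiThetaHalf (z τ : ℂ) : ℂ :=
  cexp (Real.pi * I * τ / 4 + Real.pi * I * z) * jacobiTheta₂ (z + τ / 2) τ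

lemma theta_zero_zero (z τ : ℂ) : theta 0 0 z τ = jacobiTheta₂ z τ := by
  refine tsum_congr fun n ↦ ?_
  rw [jacobiTheta₂_term]
  congr 1
  push_cast
  ring

lemma theta_zero_one (τ : ℂ) : theta 0 1 0 τ = jacobiTheta₂ (1 / 2) τ := by
  refine tsum_congr fun n ↦ ?_
  rw [jacobiTheta₂_term]
  congr 1
  push_cast
  ring

lemma theta_one_left (ε : ℝ) (z τ : ℂ) : theta 1 ε z τ = jacobiThetaHalf (z + ε / 2) τ := by
  rw [jacobiThetaHalf, jacobiTheta₂, ← tsum_mul_left]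
  refine tsum_congr fun n ↦ ?_
  rw [jacobiTheta₂_term, ← Complex.exp_add]
  congr 1
  push_cast
  ring

/-! ### Product formulas and symmetries -/

/-- The splitting of `ℤ × ℤ` according to the parity of the sum of the coordinates, written in the
coordinates half-sum and half-difference. -/
def intProdParityEquiv : (ℤ × ℤ) ⊕ (ℤ × ℤ) ≃ ℤ × ℤ where
  toFun
    | Sum.inl p => (p.1 + p.2, p.1 - p.2)
    | Sum.inr p => (p.1 + p.2 + 1, p.1 - p.2)
  invFun q := if (q.1 + q.2) % 2 = 0 then Sum.inl ((q.1 + q.2) / 2, (q.1 - q.2) / 2)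
    else Sum.inr ((q.1 + q.2 - 1) / 2, (q.1 - q.2 - 1) / 2)
  left_inv := by
    rintro (⟨k, l⟩ | ⟨k, l⟩)
    · dsimp only
      split_ifs with h
      · simp only [Sum.inl.injEq, Prod.mk.injEq]
        omega
      · omega
    · dsimp only
      split_ifs with h
      · omega
      · simp only [Sum.inr.injEq, Prod.mk.injEq]
        omega
  right_inv := by
    rintro ⟨m, n⟩
    dsimp only
    split_ifs with h
    · simp only [Prod.mk.injEq]
      omega
    · simp only [Prod.mk.injEq]
      omega

lemma two_mul_im_pos {τ : ℂ} (hτ : 0 < τ.im) : 0 < (2 * τ).im := by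
  simpa using hτ

lemma summable_norm_jacobiTheta₂_term (z : ℂ) {τ : ℂ} (hτ : 0 < τ.im) :
    Summable fun n ↦ ‖jacobiTheta₂_term n z τ‖ :=
  ((summable_jacobiTheta₂_term_iff z τ).mpr hτ).norm

/-- With m = k + l, n = k - l one has m² + n² = 2k² + 2l², so pairs with even sum give theta series
at 2τ. For odd sum, k and l are shifted by 1/2, which produces `jacobiThetaHalf`. -/
lemma jacobiTheta₂_mul_jacobiTheta₂ (x y : ℂ) {τ : ℂ} (hτ : 0 < τ.im) :
    jacobiTheta₂ x τ * jacobiTheta₂ y τ =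
      jacobiTheta₂ (x + y) (2 * τ) * jacobiTheta₂ (x - y) (2 * τ) +
      jacobiThetaHalf (x + y) (2 * τ) * jacobiThetaHalf (x - y) (2 * τ) := by
  have hx := summable_norm_jacobiTheta₂_term x hτ
  have hy := summable_norm_jacobiTheta₂_term y hτ
  have h2 := two_mul_im_pos hτ
  have hs := (summable_mul_of_summable_norm hx hy).comp_injective intProdParityEquiv.injective
  have e1 : jacobiTheta₂ x τ * jacobiTheta₂ y τ = ∑' p : ℤ × ℤ,
      jacobiTheta₂_term p.1 x τ * jacobiTheta₂_term p.2 y τ :=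
    tsum_mul_tsum_of_summable_norm hx hy
  have e2 : jacobiTheta₂ (x + y) (2 * τ) * jacobiTheta₂ (x - y) (2 * τ) = ∑' p : ℤ × ℤ,
      jacobiTheta₂_term p.1 (x + y) (2 * τ) * jacobiTheta₂_term p.2 (x - y) (2 * τ) :=
    tsum_mul_tsum_of_summable_norm (summable_norm_jacobiTheta₂_term _ h2)
      (summable_norm_jacobiTheta₂_term _ h2)
  have e3 : jacobiThetaHalf (x + y) (2 * τ) * jacobiThetaHalf (x - y) (2 * τ) = ∑' p : ℤ × ℤ,
      cexp (Real.pi * I * τ + 2 * Real.pi * I * x) *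
      (jacobiTheta₂_term p.1 (x + y + τ) (2 * τ) *
        jacobiTheta₂_term p.2 (x - y + τ) (2 * τ)) := by
    rw [tsum_mul_left, ← tsum_mul_tsum_of_summable_norm (summable_norm_jacobiTheta₂_term _ h2)
      (summable_norm_jacobiTheta₂_term _ h2), jacobiThetaHalf, jacobiThetaHalf, mul_mul_mul_comm,
      ← Complex.exp_add, mul_div_cancel_left₀ _ (two_ne_zero' ℂ)]
    unfold jacobiTheta₂
    congr 2
    ring
  rw [e1, e2, e3, ← intProdParityEquiv.tsum_eq]
  refine (Summable.tsum_sum (hs.comp_injective Sum.inl_injective)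
    (hs.comp_injective Sum.inr_injective)).trans ?_
  congr 1 <;> refine tsum_congr fun p ↦ ?_
  · change jacobiTheta₂_term (p.1 + p.2) x τ * jacobiTheta₂_term (p.1 - p.2) y τ = _
    simp only [jacobiTheta₂_term, ← Complex.exp_add]
    congr 1
    push_cast
    ring
  · change jacobiTheta₂_term (p.1 + p.2 + 1) x τ * jacobiTheta₂_term (p.1 - p.2) y τ = _
    simp only [jacobiTheta₂_term, ← Complex.exp_add]
    congr 1
    push_cast
    ring

lemma jacobiThetaHalf_add_self (z τ : ℂ) :
    jacobiThetaHalf (z + τ / 2) τ = cexp (-Real.pi * I * (τ / 4 + z)) * jacobiTheta₂ z τ := by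
  rw [jacobiThetaHalf, add_assoc, add_halves, jacobiTheta₂_add_left', ← mul_assoc,
    ← Complex.exp_add]
  congr 2
  ring

/-- Shifting x and y by τ/2 leaves x - y fixed and moves x + y by half the period 2τ, which
exchanges the two kinds of theta function in the sum variable. -/
lemma jacobiThetaHalf_mul_jacobiThetaHalf (x y : ℂ) {τ : ℂ} (hτ : 0 < τ.im) :
    jacobiThetaHalf x τ * jacobiThetaHalf y τ =
      jacobiTheta₂ (x + y) (2 * τ) * jacobiThetaHalf (x - y) (2 * τ) +
      jacobiThetaHalf (x + y) (2 * τ) * jacobiTheta₂ (x - y) (2 * τ) := by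
  have h := jacobiTheta₂_mul_jacobiTheta₂ (x + τ / 2) (y + τ / 2) hτ
  have e1 : x + τ / 2 + (y + τ / 2) = x + y + 2 * τ / 2 := by ring
  have e2 : x + τ / 2 - (y + τ / 2) = x - y := by ring
  rw [e1, e2, jacobiThetaHalf_add_self] at h
  rw [jacobiThetaHalf, jacobiThetaHalf, mul_mul_mul_comm, h, jacobiThetaHalf.eq_1 (x + y),
    ← Complex.exp_add, mul_add]
  have e3 : cexp (Real.pi * I * τ / 4 + Real.pi * I * x + (Real.pi * I * τ / 4 + Real.pi * I * y))
      * cexp (-Real.pi * I * (2 * τ / 4 + (x + y))) = 1 := by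
    rw [← Complex.exp_add, ← Complex.exp_zero]
    congr 1
    ring
  have e4 : cexp (Real.pi * I * τ / 4 + Real.pi * I * x + (Real.pi * I * τ / 4 + Real.pi * I * y))
      = cexp (Real.pi * I * (2 * τ) / 4 + Real.pi * I * (x + y)) := by
    congr 1
    ring
  rw [add_comm]
  congr 1
  · linear_combination (jacobiTheta₂ (x + y) (2 * τ) * jacobiThetaHalf (x - y) (2 * τ)) * e3
  · rw [e4]
    ring

lemma jacobiThetaHalf_neg (z τ : ℂ) : jacobiThetaHalf (-z) τ = jacobiThetaHalf z τ := by
  rw [jacobiThetaHalf, jacobiThetaHalf, ← jacobiTheta₂_neg_left,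
    (by ring : -(-z + τ / 2) = z - τ / 2), (by ring : z + τ / 2 = z - τ / 2 + τ),
    jacobiTheta₂_add_left', ← mul_assoc, ← Complex.exp_add]
  congr 2
  ring

lemma jacobiThetaHalf_add_one (z τ : ℂ) :
    jacobiThetaHalf (z + 1) τ = -jacobiThetaHalf z τ := by
  rw [jacobiThetaHalf, jacobiThetaHalf, add_right_comm, jacobiTheta₂_add_left, mul_add, mul_one,
    ← add_assoc, Complex.exp_add _ (Real.pi * I), Complex.exp_pi_mul_I]
  ring

lemma jacobiThetaHalf_half (τ : ℂ) : jacobiThetaHalf (1 / 2) τ = 0 := by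
  have h := jacobiThetaHalf_add_one (-(1 / 2)) τ
  rw [jacobiThetaHalf_neg, (by norm_num : -(1 / 2 : ℂ) + 1 = 1 / 2)] at h
  linear_combination h / 2

lemma jacobiTheta₂_quarter {τ : ℂ} (hτ : 0 < τ.im) :
    jacobiTheta₂ (1 / 4) τ = jacobiTheta₂ (1 / 2) (4 * τ) := by
  have hp := (summable_jacobiTheta₂_term_iff (1 / 4) τ).mpr hτ
  have hm := (summable_jacobiTheta₂_term_iff (-(1 / 4)) τ).mpr hτ
  have h : jacobiTheta₂ (1 / 4) τ = (1 / 2) *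
      ∑' n : ℤ, (jacobiTheta₂_term n (1 / 4) τ + jacobiTheta₂_term n (-(1 / 4)) τ) := by
    rw [hp.tsum_add hm]
    change _ = 1 / 2 * (jacobiTheta₂ (1 / 4) τ + jacobiTheta₂ (-(1 / 4)) τ)
    rw [jacobiTheta₂_neg_left]
    ring
  have hinj : Function.Injective fun n : ℤ ↦ 2 * n := mul_right_injective₀ two_ne_zero
  rw [h, ← hinj.tsum_eq, ← tsum_mul_left]
  · refine tsum_congr fun n ↦ ?_
    have h1 : jacobiTheta₂_term (2 * n) (1 / 4) τ = jacobiTheta₂_term n (1 / 2) (4 * τ) := by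
      simp only [jacobiTheta₂_term]
      congr 1
      push_cast
      ring
    have h2 : jacobiTheta₂_term (2 * n) (-(1 / 4)) τ = jacobiTheta₂_term n (1 / 2) (4 * τ) := by
      simp only [jacobiTheta₂_term]
      -- The exponents contain -πin and πin, which differ by -n periods 2πi.
      refine Complex.exp_eq_exp_iff_exists_int.mpr ⟨-n, ?_⟩
      push_cast
      ring
    rw [h1, h2]
    ring
  -- Terms with n odd cancel in the average over ±1/4, since i^n + i^(-n) = 0.
  · intro n hn
    by_contra hr
    have hodd : Odd n := by
      rw [← Int.not_even_iff_odd]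
      exact fun ⟨m, hm⟩ ↦ hr ⟨m, by simp only; omega⟩
    obtain ⟨m, rfl⟩ := hodd
    refine hn ?_
    simp only [jacobiTheta₂_term]
    rw [add_eq_zero_iff_eq_neg, ← neg_one_mul, ← Complex.exp_pi_mul_I, ← Complex.exp_add]
    refine Complex.exp_eq_exp_iff_exists_int.mpr ⟨m, ?_⟩
    push_cast
    ring

/-! ### Derivatives in the first variable -/

/-- The derivative of `jacobiThetaHalf` in its first variable. -/
noncomputable def jacobiThetaHalf' (z τ : ℂ) : ℂ :=
  Real.pi * I * jacobiThetaHalf z τ +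
    cexp (Real.pi * I * τ / 4 + Real.pi * I * z) * jacobiTheta₂' (z + τ / 2) τ

lemma hasDerivAt_jacobiThetaHalf (z : ℂ) {τ : ℂ} (hτ : 0 < τ.im) :
    HasDerivAt (jacobiThetaHalf · τ) (jacobiThetaHalf' z τ) z := by
  have h1 : HasDerivAt (fun z ↦ cexp (Real.pi * I * τ / 4 + Real.pi * I * z))
      (cexp (Real.pi * I * τ / 4 + Real.pi * I * z) * (Real.pi * I * 1)) z :=
    (((hasDerivAt_id z).const_mul _).const_add _).cexp
  have h2 := (hasDerivAt_jacobiTheta₂_fst (z + τ / 2) hτ).comp_add_const z (τ / 2)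
  refine (h1.mul h2).congr_deriv ?_
  rw [jacobiThetaHalf', jacobiThetaHalf]
  ring

lemma jacobiThetaHalf'_neg (z : ℂ) {τ : ℂ} (hτ : 0 < τ.im) :
    jacobiThetaHalf' (-z) τ = -jacobiThetaHalf' z τ := by
  have h := (hasDerivAt_jacobiThetaHalf (- -z) hτ).scomp (-z) (hasDerivAt_neg (-z))
  have e : (jacobiThetaHalf · τ) ∘ Neg.neg = (jacobiThetaHalf · τ) :=
    funext fun w ↦ jacobiThetaHalf_neg w τ
  rw [e, neg_neg] at h
  simpa using (hasDerivAt_jacobiThetaHalf (-z) hτ).unique h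

lemma jacobiTheta₂'_half (τ : ℂ) : jacobiTheta₂' (1 / 2) τ = 0 := by
  have h := jacobiTheta₂'_add_left (-(1 / 2)) τ
  rw [jacobiTheta₂'_neg_left, (by norm_num : -(1 / 2 : ℂ) + 1 = 1 / 2)] at h
  linear_combination h / 2

/-- Differentiate the product formula for p + w and r - w at w = 0: the sum stays constant and the
difference is p - r + 2w, whence the factor 2. -/
lemma jacobiThetaHalf'_mul_sub (p r : ℂ) {τ : ℂ} (hτ : 0 < τ.im) :
    jacobiThetaHalf' p τ * jacobiThetaHalf r τ - jacobiThetaHalf p τ * jacobiThetaHalf' r τ =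
      2 * (jacobiTheta₂ (p + r) (2 * τ) * jacobiThetaHalf' (p - r) (2 * τ) +
        jacobiThetaHalf (p + r) (2 * τ) * jacobiTheta₂' (p - r) (2 * τ)) := by
  have h2 := two_mul_im_pos hτ
  have hp : HasDerivAt (fun w : ℂ ↦ p + w) 1 0 := (hasDerivAt_id 0).const_add p
  have hr : HasDerivAt (fun w : ℂ ↦ r - w) (-1) 0 := (hasDerivAt_id 0).const_sub r
  have hd : HasDerivAt (fun w : ℂ ↦ p - r + 2 * w) (2 * 1) 0 :=
    ((hasDerivAt_id 0).const_mul 2).const_add (p - r)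
  have l := ((hasDerivAt_jacobiThetaHalf _ hτ).comp (0 : ℂ) hp).mul
    ((hasDerivAt_jacobiThetaHalf _ hτ).comp (0 : ℂ) hr)
  have m := (((hasDerivAt_jacobiThetaHalf _ h2).comp (0 : ℂ) hd).const_mul
      (jacobiTheta₂ (p + r) (2 * τ))).add
    (((hasDerivAt_jacobiTheta₂_fst _ h2).comp (0 : ℂ) hd).const_mul
      (jacobiThetaHalf (p + r) (2 * τ)))
  have e := l.unique (m.congr_of_eventuallyEq (Eventually.of_forall fun w ↦ ?_))
  · simp only [Function.comp_apply, add_zero, sub_zero, mul_zero, mul_one] at e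
    linear_combination e
  · have h := jacobiThetaHalf_mul_jacobiThetaHalf (p + w) (r - w) hτ
    rw [(by ring : p + w + (r - w) = p + r), (by ring : p + w - (r - w) = p - r + 2 * w)] at h
    exact h

lemma jacobiThetaHalf'_mul_add (p r : ℂ) {τ : ℂ} (hτ : 0 < τ.im) :
    jacobiThetaHalf' p τ * jacobiThetaHalf r τ + jacobiThetaHalf p τ * jacobiThetaHalf' r τ =
      2 * (jacobiTheta₂' (p + r) (2 * τ) * jacobiThetaHalf (p - r) (2 * τ) +
        jacobiThetaHalf' (p + r) (2 * τ) * jacobiTheta₂ (p - r) (2 * τ)) := by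
  have h := jacobiThetaHalf'_mul_sub p (-r) hτ
  have h2 := jacobiThetaHalf_neg r τ
  have h3 := jacobiThetaHalf'_neg r hτ
  rw [h2, h3, ← sub_eq_add_neg, sub_neg_eq_add] at h
  linear_combination h

/-! ### Limits along 2^k τ -/

lemma two_pow_mul_im_pos {τ : ℂ} (hτ : 0 < τ.im) (k : ℕ) : 0 < (2 ^ k * τ).im := by
  induction k with
  | zero => simpa using hτ
  | succ k ih =>
    rw [pow_succ', mul_assoc]
    exact two_mul_im_pos ih

/-- Doubling τ squares each exponential, so every term with positive exponent dies and the series at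
τ itself dominates. -/
lemma tendsto_tsum_mul_exp_two_pow {c : ℤ → ℂ} {e : ℤ → ℕ} {τ : ℂ} (hτ : 0 < τ.im)
    (hs : Summable fun n ↦ c n * cexp (Real.pi * I * e n * τ)) :
    Tendsto (fun k : ℕ ↦ ∑' n, c n * cexp (Real.pi * I * e n * (2 ^ k * τ))) atTop
      (𝓝 (∑' n, if e n = 0 then c n else 0)) := by
  have key (n : ℤ) (k : ℕ) : cexp (Real.pi * I * e n * (2 ^ k * τ)) =
      cexp (Real.pi * I * e n * τ) ^ (2 ^ k) := by
    rw [← Complex.exp_nat_mul]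
    congr 1
    push_cast
    ring
  have hnorm (n : ℤ) : ‖cexp (Real.pi * I * e n * τ)‖ = Real.exp (-(Real.pi * e n * τ.im)) := by
    rw [Complex.norm_exp]
    congr 1
    simp
  have hle (n : ℤ) : ‖cexp (Real.pi * I * e n * τ)‖ ≤ 1 := by
    rw [hnorm, Real.exp_le_one_iff]
    have := Real.pi_pos
    have : 0 ≤ Real.pi * e n * τ.im := by positivity
    linarith
  refine tendsto_tsum_of_dominated_convergence hs.norm (fun n ↦ ?_)
    (Eventually.of_forall fun k n ↦ ?_)
  · split_ifs with h
    · simp [h]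
    · have hlt : ‖cexp (Real.pi * I * e n * τ)‖ < 1 := by
        rw [hnorm, Real.exp_lt_one_iff]
        have := Real.pi_pos
        have : 0 < (e n : ℝ) := by exact_mod_cast Nat.pos_of_ne_zero h
        have : 0 < Real.pi * e n * τ.im := by positivity
        linarith
      simp_rw [key]
      rw [← mul_zero (c n)]
      exact ((tendsto_pow_atTop_nhds_zero_of_norm_lt_one hlt).comp
        (tendsto_pow_atTop_atTop_of_one_lt one_lt_two)).const_mul _
  · rw [key, norm_mul, norm_mul, norm_pow]
    gcongr
    exact pow_le_of_le_one (norm_nonneg _) (hle n) (by positivity)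

lemma tendsto_jacobiTheta₂_two_pow (z : ℂ) {τ : ℂ} (hτ : 0 < τ.im) :
    Tendsto (fun k : ℕ ↦ jacobiTheta₂ z (2 ^ k * τ)) atTop (𝓝 1) := by
  have key (n : ℤ) (τ : ℂ) : jacobiTheta₂_term n z τ =
      cexp (2 * Real.pi * I * n * z) * cexp (Real.pi * I * (n.natAbs ^ 2 : ℕ) * τ) := by
    have : ((n.natAbs ^ 2 : ℕ) : ℂ) = (n : ℂ) ^ 2 := by
      rw [← Int.cast_natCast]
      push_cast
      exact_mod_cast sq_abs n
    rw [jacobiTheta₂_term, this, ← Complex.exp_add]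
  have hs := (summable_jacobiTheta₂_term_iff z τ).mpr hτ
  simp_rw [key] at hs
  have h := tendsto_tsum_mul_exp_two_pow hτ hs
  simp_rw [← key] at h
  convert h using 2
  · rfl
  · rw [tsum_eq_single 0 (by intro n hn; simp [hn])]
    simp

/-- `n * (n + 1)` as a natural number. -/
def intMulSucc (n : ℤ) : ℕ := (n * (n + 1)).toNat

lemma intMulSucc_cast (n : ℤ) : (intMulSucc n : ℂ) = n * (n + 1) := by
  have h : (0 : ℤ) ≤ n * (n + 1) := by
    rcases lt_or_ge n 0 with h | h
    · exact mul_nonneg_of_nonpos_of_nonpos h.le (by omega)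
    · positivity
  have h2 : ((intMulSucc n : ℤ) : ℂ) = ((n * (n + 1) : ℤ) : ℂ) := by
    rw [intMulSucc, Int.toNat_of_nonneg h]
  simpa using h2

lemma intMulSucc_eq_zero {n : ℤ} : intMulSucc n = 0 ↔ n = 0 ∨ n = -1 := by
  rw [← Nat.cast_eq_zero (R := ℂ), intMulSucc_cast, mul_eq_zero, add_eq_zero_iff_eq_neg]
  norm_cast

lemma tsum_ite_intMulSucc (c : ℤ → ℂ) :
    ∑' n, (if intMulSucc n = 0 then c n else 0) = c 0 + c (-1) := by
  rw [tsum_eq_sum (s := {0, -1}), Finset.sum_pair (by norm_num)]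
  · simp [intMulSucc_eq_zero]
  · intro n hn
    rw [if_neg]
    simpa [intMulSucc_eq_zero] using hn

lemma jacobiTheta₂_term_add_half (n : ℤ) (z τ : ℂ) : jacobiTheta₂_term n (z + τ / 2) τ =
    cexp (2 * Real.pi * I * n * z) * cexp (Real.pi * I * intMulSucc n * τ) := by
  rw [jacobiTheta₂_term, intMulSucc_cast, ← Complex.exp_add]
  congr 1
  ring

lemma tendsto_jacobiTheta₂_add_half_two_pow (z : ℂ) {τ : ℂ} (hτ : 0 < τ.im) :
    Tendsto (fun k : ℕ ↦ jacobiTheta₂ (z + 2 ^ k * τ / 2) (2 ^ k * τ)) atTop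
      (𝓝 (1 + cexp (-(2 * Real.pi * I * z)))) := by
  have hs := (summable_jacobiTheta₂_term_iff (z + τ / 2) τ).mpr hτ
  simp_rw [jacobiTheta₂_term_add_half] at hs
  have h := tendsto_tsum_mul_exp_two_pow hτ hs
  rw [tsum_ite_intMulSucc] at h
  simp_rw [← jacobiTheta₂_term_add_half] at h
  convert h using 2
  · rfl
  · simp

lemma tendsto_jacobiTheta₂'_add_half_two_pow (z : ℂ) {τ : ℂ} (hτ : 0 < τ.im) :
    Tendsto (fun k : ℕ ↦ jacobiTheta₂' (z + 2 ^ k * τ / 2) (2 ^ k * τ)) atTop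
      (𝓝 (-(2 * Real.pi * I) * cexp (-(2 * Real.pi * I * z)))) := by
  have hs := (summable_jacobiTheta₂'_term_iff (z + τ / 2) τ).mpr hτ
  simp_rw [jacobiTheta₂'_term, jacobiTheta₂_term_add_half, ← mul_assoc _ (cexp _)] at hs
  have h := tendsto_tsum_mul_exp_two_pow hτ hs
  rw [tsum_ite_intMulSucc] at h
  simp_rw [mul_assoc _ (cexp _), ← jacobiTheta₂_term_add_half] at h
  convert h using 2
  · rfl
  · simp

/-- The factor cancels exp(πiτ/4); the terms n = 0 and n = -1 survive and give e^(πiz) + e^(-πiz).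
-/
lemma tendsto_exp_mul_jacobiThetaHalf (z : ℂ) {τ : ℂ} (hτ : 0 < τ.im) :
    Tendsto (fun k : ℕ ↦ cexp (-(Real.pi * I * (2 ^ k * τ) / 4)) * jacobiThetaHalf z (2 ^ k * τ))
      atTop (𝓝 (2 * Complex.cos (Real.pi * z))) := by
  have h := (tendsto_jacobiTheta₂_add_half_two_pow z hτ).const_mul (cexp (Real.pi * I * z))
  convert h using 2 with k
  · rw [jacobiThetaHalf, ← mul_assoc, ← Complex.exp_add]
    congr 2
    ring
  · rw [mul_add, ← Complex.exp_add, Complex.two_cos]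
    ring_nf

lemma tendsto_exp_mul_jacobiThetaHalf'_half {τ : ℂ} (hτ : 0 < τ.im) :
    Tendsto (fun k : ℕ ↦ cexp (-(Real.pi * I * (2 ^ k * τ) / 4)) *
      jacobiThetaHalf' (1 / 2) (2 ^ k * τ)) atTop (𝓝 (-(2 * Real.pi))) := by
  have h := (tendsto_jacobiTheta₂'_add_half_two_pow (1 / 2) hτ).const_mul
    (cexp (Real.pi * I * (1 / 2)))
  convert h using 2 with k
  · rw [jacobiThetaHalf', jacobiThetaHalf_half, mul_zero, zero_add, ← mul_assoc,
      ← Complex.exp_add]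
    congr 2
    ring
  · have h1 : cexp (-(2 * Real.pi * I * (1 / 2))) = -1 := by
      rw [← Complex.exp_neg_pi_mul_I]
      congr 1
      ring
    have h2 : cexp (Real.pi * I * (1 / 2)) = I := by
      rw [(by ring : Real.pi * I * (1 / 2) = Real.pi / 2 * I), Complex.exp_pi_div_two_mul_I]
    rw [h1, h2]
    linear_combination -(2 * Real.pi : ℂ) * I_mul_I

lemma eq_of_tendsto_two_pow {f : ℂ → ℂ} {c τ : ℂ} (hf : ∀ τ : ℂ, 0 < τ.im → f (2 * τ) = f τ)
    (hτ : 0 < τ.im) (h : Tendsto (fun k : ℕ ↦ f (2 ^ k * τ)) atTop (𝓝 c)) : f τ = c := by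
  have e (k : ℕ) : f (2 ^ k * τ) = f τ := by
    induction k with
    | zero => simp
    | succ k ih => rw [pow_succ', mul_assoc, hf _ (two_pow_mul_im_pos hτ k), ih]
  simp_rw [e] at h
  exact tendsto_nhds_unique tendsto_const_nhds h

/-- A zero would propagate to all 2^k τ; the factor `g` only normalises `f` so that the limit is
nonzero. -/
lemma ne_zero_of_tendsto_two_pow {f : ℂ → ℂ} {g : ℕ → ℂ} {c τ : ℂ}
    (hf : ∀ τ : ℂ, 0 < τ.im → f τ = 0 → f (2 * τ) = 0) (hτ : 0 < τ.im) (hc : c ≠ 0)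
    (h : Tendsto (fun k : ℕ ↦ g k * f (2 ^ k * τ)) atTop (𝓝 c)) : f τ ≠ 0 := by
  intro h0
  have e (k : ℕ) : f (2 ^ k * τ) = 0 := by
    induction k with
    | zero => simpa using h0
    | succ k ih =>
      rw [pow_succ', mul_assoc]
      exact hf _ (two_pow_mul_im_pos hτ k) ih
  simp_rw [e, mul_zero] at h
  exact hc (tendsto_nhds_unique h tendsto_const_nhds)

/-! ### Special values, nonvanishing and doubling-invariant quotients -/

lemma jacobiTheta₂_zero_mul_half {τ : ℂ} (hτ : 0 < τ.im) :
    jacobiTheta₂ 0 τ * jacobiTheta₂ (1 / 2) τ = jacobiTheta₂ (1 / 2) (2 * τ) ^ 2 := by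
  rw [jacobiTheta₂_mul_jacobiTheta₂ _ _ hτ, zero_add, zero_sub, jacobiTheta₂_neg_left,
    jacobiThetaHalf_half]
  ring

lemma jacobiThetaHalf_zero_sq {τ : ℂ} (hτ : 0 < τ.im) :
    jacobiThetaHalf 0 τ ^ 2 = 2 * jacobiTheta₂ 0 (2 * τ) * jacobiThetaHalf 0 (2 * τ) := by
  rw [sq, jacobiThetaHalf_mul_jacobiThetaHalf _ _ hτ, zero_add, zero_sub, neg_zero]
  ring

lemma jacobiTheta₂_zero_sq {τ : ℂ} (hτ : 0 < τ.im) :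
    jacobiTheta₂ 0 τ ^ 2 = jacobiTheta₂ 0 (2 * τ) ^ 2 + jacobiThetaHalf 0 (2 * τ) ^ 2 := by
  rw [sq, jacobiTheta₂_mul_jacobiTheta₂ _ _ hτ, zero_add, zero_sub, neg_zero]
  ring

lemma jacobiTheta₂_quarter_sq {τ : ℂ} (hτ : 0 < τ.im) :
    jacobiTheta₂ (1 / 4) τ ^ 2 = jacobiTheta₂ (1 / 2) (2 * τ) * jacobiTheta₂ 0 (2 * τ) := by
  rw [sq, jacobiTheta₂_mul_jacobiTheta₂ _ _ hτ, sub_self,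
    (by norm_num : (1 / 4 + 1 / 4 : ℂ) = 1 / 2), jacobiThetaHalf_half]
  ring

lemma jacobiThetaHalf_quarter_sq {τ : ℂ} (hτ : 0 < τ.im) :
    jacobiThetaHalf (1 / 4) τ ^ 2 = jacobiTheta₂ (1 / 2) (2 * τ) * jacobiThetaHalf 0 (2 * τ) := by
  rw [sq, jacobiThetaHalf_mul_jacobiThetaHalf _ _ hτ, sub_self,
    (by norm_num : (1 / 4 + 1 / 4 : ℂ) = 1 / 2), jacobiThetaHalf_half]
  ring

lemma jacobiThetaHalf_zero_mul_quarter {τ : ℂ} (hτ : 0 < τ.im) :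
    jacobiThetaHalf 0 τ * jacobiThetaHalf (1 / 4) τ =
      2 * jacobiTheta₂ (1 / 4) (2 * τ) * jacobiThetaHalf (1 / 4) (2 * τ) := by
  rw [jacobiThetaHalf_mul_jacobiThetaHalf _ _ hτ, zero_add, zero_sub, jacobiTheta₂_neg_left,
    jacobiThetaHalf_neg]
  ring

lemma jacobiTheta₂_half_ne_zero {τ : ℂ} (hτ : 0 < τ.im) : jacobiTheta₂ (1 / 2) τ ≠ 0 := by
  refine ne_zero_of_tendsto_two_pow (f := jacobiTheta₂ (1 / 2)) (g := fun _ ↦ 1)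
    (fun σ hσ h ↦ ?_) hτ one_ne_zero (by simpa using tendsto_jacobiTheta₂_two_pow (1 / 2) hτ)
  have h2 := jacobiTheta₂_zero_mul_half hσ
  rw [h, mul_zero] at h2
  exact pow_eq_zero_iff two_ne_zero |>.mp h2.symm

lemma jacobiTheta₂_zero_ne_zero {τ : ℂ} (hτ : 0 < τ.im) : jacobiTheta₂ 0 τ ≠ 0 := by
  refine left_ne_zero_of_mul (b := jacobiTheta₂ (1 / 2) τ) ?_
  rw [jacobiTheta₂_zero_mul_half hτ]
  exact pow_ne_zero 2 (jacobiTheta₂_half_ne_zero (two_mul_im_pos hτ))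

lemma jacobiThetaHalf_zero_ne_zero {τ : ℂ} (hτ : 0 < τ.im) : jacobiThetaHalf 0 τ ≠ 0 := by
  refine ne_zero_of_tendsto_two_pow (f := jacobiThetaHalf 0) (fun σ hσ h ↦ ?_) hτ ?_
    (tendsto_exp_mul_jacobiThetaHalf 0 hτ)
  · have h2 := jacobiThetaHalf_zero_sq hσ
    have h3 := jacobiTheta₂_zero_ne_zero (two_mul_im_pos hσ)
    rw [h] at h2
    simpa [h3] using h2
  · simp

lemma jacobiThetaHalf_quarter_ne_zero {τ : ℂ} (hτ : 0 < τ.im) :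
    jacobiThetaHalf (1 / 4) τ ≠ 0 := by
  have h2 := two_mul_im_pos hτ
  refine (pow_ne_zero_iff two_ne_zero).mp ?_
  rw [jacobiThetaHalf_quarter_sq hτ]
  exact mul_ne_zero (jacobiTheta₂_half_ne_zero h2) (jacobiThetaHalf_zero_ne_zero h2)

/-- Jacobi's derivative formula. -/
lemma jacobiThetaHalf'_half {τ : ℂ} (hτ : 0 < τ.im) : jacobiThetaHalf' (1 / 2) τ =
    -Real.pi * (jacobiThetaHalf 0 τ * jacobiTheta₂ 0 τ * jacobiTheta₂ (1 / 2) τ) := by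
  -- The constant is the quotient of the normalised limits, -2π / (2 · 1 · 1).
  have key := eq_of_tendsto_two_pow (τ := τ) (c := -Real.pi)
    (f := fun τ ↦ jacobiThetaHalf' (1 / 2) τ /
      (jacobiThetaHalf 0 τ * jacobiTheta₂ 0 τ * jacobiTheta₂ (1 / 2) τ)) ?_ hτ ?_
  · rw [div_eq_iff] at key
    · exact key
    · exact mul_ne_zero (mul_ne_zero (jacobiThetaHalf_zero_ne_zero hτ)
        (jacobiTheta₂_zero_ne_zero hτ)) (jacobiTheta₂_half_ne_zero hτ)
  · intro τ hτ
    have h2 := two_mul_im_pos hτ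
    have n2 := jacobiThetaHalf_zero_ne_zero hτ
    have n3 := jacobiTheta₂_zero_ne_zero hτ
    have n4 := jacobiTheta₂_half_ne_zero hτ
    have m2 := jacobiThetaHalf_zero_ne_zero h2
    have m3 := jacobiTheta₂_zero_ne_zero h2
    have m4 := jacobiTheta₂_half_ne_zero h2
    -- As `jacobiThetaHalf` vanishes at 1/2, this relates its derivative there at τ to the one at
    -- 2τ.
    have e1 := jacobiThetaHalf'_mul_sub (1 / 2) 0 hτ
    rw [jacobiThetaHalf_half, add_zero, sub_zero, jacobiThetaHalf_half] at e1
    have e2 := jacobiThetaHalf_zero_sq hτ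
    have e3 := jacobiTheta₂_zero_mul_half hτ
    rw [div_eq_div_iff (mul_ne_zero (mul_ne_zero m2 m3) m4) (mul_ne_zero (mul_ne_zero n2 n3) n4)]
    refine mul_left_cancel₀ (mul_ne_zero two_ne_zero m4) ?_
    linear_combination (-jacobiThetaHalf 0 τ * jacobiTheta₂ 0 τ * jacobiTheta₂ (1 / 2) τ) * e1 +
      (jacobiThetaHalf' (1 / 2) τ * jacobiTheta₂ (1 / 2) (2 * τ) ^ 2) * e2 +
      (jacobiThetaHalf 0 τ ^ 2 * jacobiThetaHalf' (1 / 2) τ) * e3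
  · have h := (tendsto_exp_mul_jacobiThetaHalf'_half hτ).div
      (((tendsto_exp_mul_jacobiThetaHalf 0 hτ).mul (tendsto_jacobiTheta₂_two_pow 0 hτ)).mul
        (tendsto_jacobiTheta₂_two_pow (1 / 2) hτ)) (by simp)
    convert h using 2 with k
    · simp only [Pi.div_apply, mul_assoc]
      rw [mul_div_mul_left _ _ (Complex.exp_ne_zero _)]
    · rw [mul_zero, Complex.cos_zero]
      ring

lemma ofReal_sqrt_two_sq : (Real.sqrt 2 : ℂ) ^ 2 = 2 := by
  rw [← Complex.ofReal_pow, Real.sq_sqrt (by norm_num)]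
  norm_num

lemma jacobiTheta₂_quarter_mul_jacobiThetaHalf_zero {τ : ℂ} (hτ : 0 < τ.im) :
    jacobiTheta₂ (1 / 4) τ * jacobiThetaHalf 0 τ =
      Real.sqrt 2 * (jacobiTheta₂ 0 (2 * τ) * jacobiThetaHalf (1 / 4) τ) := by
  -- The constant is 2 / (2 cos(π/4)).
  have key := eq_of_tendsto_two_pow (τ := τ) (c := Real.sqrt 2)
    (f := fun τ ↦ jacobiTheta₂ (1 / 4) τ * jacobiThetaHalf 0 τ /
      (jacobiTheta₂ 0 (2 * τ) * jacobiThetaHalf (1 / 4) τ)) ?_ hτ ?_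
  · rw [div_eq_iff] at key
    · exact key
    · exact mul_ne_zero (jacobiTheta₂_zero_ne_zero (two_mul_im_pos hτ))
        (jacobiThetaHalf_quarter_ne_zero hτ)
  · intro τ hτ
    have h2 := two_mul_im_pos hτ
    have h4 := two_mul_im_pos h2
    have n2 := jacobiThetaHalf_zero_ne_zero hτ
    have m2 := jacobiThetaHalf_zero_ne_zero h2
    have m3 := jacobiTheta₂_zero_ne_zero h2
    have nA := jacobiThetaHalf_quarter_ne_zero hτ
    have mA := jacobiThetaHalf_quarter_ne_zero h2
    have p3 := jacobiTheta₂_zero_ne_zero h4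
    have e1 := jacobiThetaHalf_zero_mul_quarter hτ
    have e2 := jacobiThetaHalf_zero_sq hτ
    have e3 := jacobiTheta₂_quarter_sq h2
    rw [(by ring : 2 * (2 * τ) = 4 * τ)] at p3 e3 ⊢
    rw [← jacobiTheta₂_quarter hτ] at e3
    rw [div_eq_div_iff (mul_ne_zero p3 mA) (mul_ne_zero m3 nA)]
    refine mul_left_cancel₀ (mul_ne_zero two_ne_zero n2) ?_
    linear_combination
      (2 * jacobiTheta₂ (1 / 4) (2 * τ) * jacobiThetaHalf 0 (2 * τ) * jacobiTheta₂ 0 (2 * τ)) * e1 +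
      (-2 * jacobiTheta₂ (1 / 4) τ * jacobiTheta₂ 0 (4 * τ) * jacobiThetaHalf (1 / 4) (2 * τ)) * e2 +
      (4 * jacobiTheta₂ 0 (2 * τ) * jacobiThetaHalf 0 (2 * τ) * jacobiThetaHalf (1 / 4) (2 * τ)) * e3
  · have hc : Complex.cos (Real.pi * (1 / 4)) = Real.sqrt 2 / 2 := by
      have h := congrArg (fun x : ℝ ↦ (x : ℂ)) Real.cos_pi_div_four
      push_cast at h
      rw [← h]
      congr 1
      ring
    have hs : (Real.sqrt 2 : ℂ) ≠ 0 := by simp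
    have h := ((tendsto_jacobiTheta₂_two_pow (1 / 4) hτ).mul
      (tendsto_exp_mul_jacobiThetaHalf 0 hτ)).div
      ((tendsto_jacobiTheta₂_two_pow 0 (two_mul_im_pos hτ)).mul
        (tendsto_exp_mul_jacobiThetaHalf (1 / 4) hτ)) (by rw [hc]; simp)
    convert h using 2 with k
    · simp only [mul_left_comm _ (cexp _), mul_left_comm _ (2 : ℂ)]
      simp only [Pi.div_apply]
      rw [mul_div_mul_left _ _ (Complex.exp_ne_zero _)]
    · rw [hc]
      simp only [mul_zero, Complex.cos_zero]
      field_simp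
      linear_combination ofReal_sqrt_two_sq

/-! ### Values and derivatives at 1/8 and 3/8 -/

lemma jacobiThetaHalf_eighth_sq {τ : ℂ} (hτ : 0 < τ.im) : jacobiThetaHalf (1 / 8) τ ^ 2 =
    jacobiThetaHalf (1 / 4) (2 * τ) *
      (Real.sqrt 2 * jacobiTheta₂ 0 (4 * τ) + jacobiTheta₂ 0 (2 * τ)) := by
  have h := jacobiTheta₂_quarter_mul_jacobiThetaHalf_zero (two_mul_im_pos hτ)
  rw [(by ring : 2 * (2 * τ) = 4 * τ)] at h
  rw [sq, jacobiThetaHalf_mul_jacobiThetaHalf _ _ hτ, sub_self,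
    (by norm_num : (1 / 8 + 1 / 8 : ℂ) = 1 / 4), h]
  ring

lemma jacobiThetaHalf_three_eighths_sq {τ : ℂ} (hτ : 0 < τ.im) : jacobiThetaHalf (3 / 8) τ ^ 2 =
    jacobiThetaHalf (1 / 4) (2 * τ) *
      (Real.sqrt 2 * jacobiTheta₂ 0 (4 * τ) - jacobiTheta₂ 0 (2 * τ)) := by
  have h := jacobiTheta₂_quarter_mul_jacobiThetaHalf_zero (two_mul_im_pos hτ)
  rw [(by ring : 2 * (2 * τ) = 4 * τ)] at h
  rw [sq, jacobiThetaHalf_mul_jacobiThetaHalf _ _ hτ, sub_self,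
    (by norm_num : (3 / 8 + 3 / 8 : ℂ) = -(1 / 4) + 1), jacobiTheta₂_add_left,
    jacobiTheta₂_neg_left, jacobiThetaHalf_add_one, jacobiThetaHalf_neg, h]
  ring

lemma jacobiThetaHalf_three_eighths_mul_eighth {τ : ℂ} (hτ : 0 < τ.im) :
    jacobiThetaHalf (3 / 8) τ * jacobiThetaHalf (1 / 8) τ =
      jacobiTheta₂ (1 / 2) (2 * τ) * jacobiThetaHalf (1 / 4) (2 * τ) := by
  rw [jacobiThetaHalf_mul_jacobiThetaHalf _ _ hτ, (by norm_num : (3 / 8 + 1 / 8 : ℂ) = 1 / 2),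
    (by norm_num : (3 / 8 - 1 / 8 : ℂ) = 1 / 4), jacobiThetaHalf_half]
  ring

/-- Taking p = r = 1/4 puts the sum at 1/2, where Jacobi's derivative formula at 2τ applies. -/
lemma jacobiThetaHalf'_quarter {τ : ℂ} (hτ : 0 < τ.im) : jacobiThetaHalf' (1 / 4) τ =
    -Real.pi * jacobiTheta₂ 0 (2 * τ) ^ 2 * jacobiThetaHalf (1 / 4) τ := by
  have h := jacobiThetaHalf'_mul_add (1 / 4) (1 / 4) hτ
  rw [sub_self, (by norm_num : (1 / 4 + 1 / 4 : ℂ) = 1 / 2), jacobiTheta₂'_half,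
    jacobiThetaHalf'_half (two_mul_im_pos hτ)] at h
  refine mul_right_cancel₀ (jacobiThetaHalf_quarter_ne_zero hτ) ?_
  linear_combination h / 2 +
    Real.pi * jacobiTheta₂ 0 (2 * τ) ^ 2 * jacobiThetaHalf_quarter_sq hτ

lemma jacobiThetaHalf'_sub_eighths {τ : ℂ} (hτ : 0 < τ.im) :
    jacobiThetaHalf' (3 / 8) τ * jacobiThetaHalf (1 / 8) τ -
      jacobiThetaHalf (3 / 8) τ * jacobiThetaHalf' (1 / 8) τ =
    -2 * Real.pi * jacobiTheta₂ 0 (4 * τ) ^ 2 *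
      (jacobiThetaHalf (3 / 8) τ * jacobiThetaHalf (1 / 8) τ) := by
  have h2 := jacobiThetaHalf'_quarter (two_mul_im_pos hτ)
  rw [(by ring : 2 * (2 * τ) = 4 * τ)] at h2
  rw [jacobiThetaHalf'_mul_sub _ _ hτ, jacobiThetaHalf_three_eighths_mul_eighth hτ,
    (by norm_num : (3 / 8 + 1 / 8 : ℂ) = 1 / 2), (by norm_num : (3 / 8 - 1 / 8 : ℂ) = 1 / 4),
    jacobiThetaHalf_half, h2]
  ring

/-- Here 3/8 + 1/8 = 1/2 brings in Jacobi's formula at 2τ; in the difference identity, 3/8 - 1/8 =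
1/4 brings in the derivative at 1/4. -/
lemma jacobiThetaHalf'_add_eighths {τ : ℂ} (hτ : 0 < τ.im) :
    jacobiThetaHalf' (3 / 8) τ * jacobiThetaHalf (1 / 8) τ +
      jacobiThetaHalf (3 / 8) τ * jacobiThetaHalf' (1 / 8) τ =
    -2 * Real.pi * Real.sqrt 2 * jacobiTheta₂ 0 (2 * τ) * jacobiTheta₂ 0 (4 * τ) *
      (jacobiThetaHalf (3 / 8) τ * jacobiThetaHalf (1 / 8) τ) := by
  have h2 := two_mul_im_pos hτ
  have h := jacobiTheta₂_quarter_mul_jacobiThetaHalf_zero h2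
  rw [(by ring : 2 * (2 * τ) = 4 * τ)] at h
  rw [jacobiThetaHalf'_mul_add _ _ hτ, jacobiThetaHalf_three_eighths_mul_eighth hτ,
    (by norm_num : (3 / 8 + 1 / 8 : ℂ) = 1 / 2), (by norm_num : (3 / 8 - 1 / 8 : ℂ) = 1 / 4),
    jacobiTheta₂'_half, jacobiThetaHalf'_half h2]
  linear_combination
    (-2 * Real.pi * jacobiTheta₂ 0 (2 * τ) * jacobiTheta₂ (1 / 2) (2 * τ)) * h

lemma jacobiThetaHalf_eighths_ne_zero {τ : ℂ} (hτ : 0 < τ.im) :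
    jacobiThetaHalf (3 / 8) τ * jacobiThetaHalf (1 / 8) τ ≠ 0 := by
  rw [jacobiThetaHalf_three_eighths_mul_eighth hτ]
  exact mul_ne_zero (jacobiTheta₂_half_ne_zero (two_mul_im_pos hτ))
    (jacobiThetaHalf_quarter_ne_zero (two_mul_im_pos hτ))

lemma jacobiThetaHalf'_eighth {τ : ℂ} (hτ : 0 < τ.im) : jacobiThetaHalf' (1 / 8) τ =
    Real.pi * jacobiTheta₂ 0 (4 * τ) *
      (jacobiTheta₂ 0 (4 * τ) - Real.sqrt 2 * jacobiTheta₂ 0 (2 * τ)) *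
        jacobiThetaHalf (1 / 8) τ := by
  refine mul_left_cancel₀ (left_ne_zero_of_mul (jacobiThetaHalf_eighths_ne_zero hτ)) ?_
  linear_combination (jacobiThetaHalf'_add_eighths hτ - jacobiThetaHalf'_sub_eighths hτ) / 2

lemma jacobiThetaHalf'_three_eighths {τ : ℂ} (hτ : 0 < τ.im) : jacobiThetaHalf' (3 / 8) τ =
    -Real.pi * jacobiTheta₂ 0 (4 * τ) *
      (jacobiTheta₂ 0 (4 * τ) + Real.sqrt 2 * jacobiTheta₂ 0 (2 * τ)) *
        jacobiThetaHalf (3 / 8) τ := by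
  refine mul_right_cancel₀ (right_ne_zero_of_mul (jacobiThetaHalf_eighths_ne_zero hτ)) ?_
  linear_combination (jacobiThetaHalf'_add_eighths hτ + jacobiThetaHalf'_sub_eighths hτ) / 2

/-- With a = θ₃(4τ), b = θ₃(2τ), c = θ₂(4τ): (√2a + b)² + (√2a - b)² = 4a² + 2b², and b² = a² + c².
-/
lemma jacobiThetaHalf_eighths_pow_four_add {τ : ℂ} (hτ : 0 < τ.im) :
    jacobiThetaHalf (1 / 8) τ ^ 4 + jacobiThetaHalf (3 / 8) τ ^ 4 =
      2 * jacobiTheta₂ (1 / 2) (4 * τ) * jacobiThetaHalf 0 (4 * τ) *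
        (3 * jacobiTheta₂ 0 (4 * τ) ^ 2 + jacobiThetaHalf 0 (4 * τ) ^ 2) := by
  have h2 := two_mul_im_pos hτ
  have hA := jacobiThetaHalf_quarter_sq h2
  have h3 := jacobiTheta₂_zero_sq h2
  rw [(by ring : 2 * (2 * τ) = 4 * τ)] at hA h3
  have e (x : ℂ) : x ^ 4 = (x ^ 2) ^ 2 := by ring
  rw [e, e (jacobiThetaHalf (3 / 8) τ), jacobiThetaHalf_eighth_sq hτ,
    jacobiThetaHalf_three_eighths_sq hτ]
  simp only [mul_pow]
  rw [hA]
  linear_combination (2 * jacobiTheta₂ (1 / 2) (4 * τ) * jacobiThetaHalf 0 (4 * τ)) *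
    (h3 + jacobiTheta₂ 0 (4 * τ) ^ 2 * ofReal_sqrt_two_sq)

/-- In the same notation, and with θ₂(2τ)² = 2ac, both sides equal 8acb² θ₄(4τ). This is the bridge
from the closed logarithmic derivatives to the form with X and D. -/
lemma sqrt_two_mul_jacobiThetaHalf_eighths_pow_four_sub {τ : ℂ} (hτ : 0 < τ.im) :
    Real.sqrt 2 * jacobiTheta₂ 0 (2 * τ) *
      (jacobiThetaHalf (1 / 8) τ ^ 4 - jacobiThetaHalf (3 / 8) τ ^ 4) =
    jacobiThetaHalf 0 (2 * τ) ^ 2 * jacobiTheta₂ (1 / 2) (4 * τ) *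
      (jacobiTheta₂ 0 (4 * τ) ^ 2 + 3 * jacobiThetaHalf 0 (4 * τ) ^ 2) +
    jacobiTheta₂ 0 (4 * τ) *
      (jacobiThetaHalf (1 / 8) τ ^ 4 + jacobiThetaHalf (3 / 8) τ ^ 4) := by
  have h2 := two_mul_im_pos hτ
  have hA := jacobiThetaHalf_quarter_sq h2
  have h3 := jacobiTheta₂_zero_sq h2
  have hb := jacobiThetaHalf_zero_sq h2
  rw [(by ring : 2 * (2 * τ) = 4 * τ)] at hA h3 hb
  have e (x : ℂ) : x ^ 4 = (x ^ 2) ^ 2 := by ring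
  rw [jacobiThetaHalf_eighths_pow_four_add hτ, hb, e, e (jacobiThetaHalf (3 / 8) τ),
    jacobiThetaHalf_eighth_sq hτ, jacobiThetaHalf_three_eighths_sq hτ]
  simp only [mul_pow]
  rw [hA]
  linear_combination (8 * jacobiTheta₂ (1 / 2) (4 * τ) * jacobiThetaHalf 0 (4 * τ) *
    jacobiTheta₂ 0 (4 * τ)) * h3 + (4 * jacobiTheta₂ (1 / 2) (4 * τ) * jacobiThetaHalf 0 (4 * τ) *
    jacobiTheta₂ 0 (4 * τ) * jacobiTheta₂ 0 (2 * τ) ^ 2) * ofReal_sqrt_two_sq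

lemma exists_jacobiThetaHalf_eighths_pow_four_add_ne_zero : ∃ τ : UpperHalfPlane,
    jacobiThetaHalf (1 / 8) (τ : ℂ) ^ 4 + jacobiThetaHalf (3 / 8) (τ : ℂ) ^ 4 ≠ 0 := by
  by_contra! h0
  have hI : 0 < I.im := by simp
  have hp (k : ℕ) := two_pow_mul_im_pos hI k
  have hz (σ : ℂ) (hσ : 0 < σ.im) :
      3 * jacobiTheta₂ 0 (4 * σ) ^ 2 + jacobiThetaHalf 0 (4 * σ) ^ 2 = 0 := by
    have h := h0 ⟨σ, hσ⟩
    have h4 : 0 < (4 * σ).im := by simpa using hσ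
    rw [UpperHalfPlane.coe_mk, jacobiThetaHalf_eighths_pow_four_add hσ] at h
    exact (mul_eq_zero_iff_left (mul_ne_zero (mul_ne_zero two_ne_zero
      (jacobiTheta₂_half_ne_zero h4)) (jacobiThetaHalf_zero_ne_zero h4))).mp h
  -- Vanishing of D would give b² = a² + c² = -2a², which becomes 1 = -2 in the limit.
  have hsq (σ : ℂ) (hσ : 0 < σ.im) : jacobiTheta₂ 0 (2 * σ) ^ 2 =
      -2 * jacobiTheta₂ 0 (4 * σ) ^ 2 := by
    have h := jacobiTheta₂_zero_sq (two_mul_im_pos hσ)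
    rw [(by ring : 2 * (2 * σ) = 4 * σ)] at h
    linear_combination h + hz σ hσ
  have t2 := (tendsto_jacobiTheta₂_two_pow 0 (two_mul_im_pos hI)).pow 2
  have t4 := ((tendsto_jacobiTheta₂_two_pow 0
    (two_mul_im_pos (two_mul_im_pos hI))).pow 2).const_mul (-2)
  have := tendsto_nhds_unique t2 (t4.congr fun k ↦ ?_)
  · norm_num at this
  · have h := hsq _ (hp k)
    rw [(by ring : 2 * (2 ^ k * I) = 2 ^ k * (2 * I)),
      (by ring : 4 * (2 ^ k * I) = 2 ^ k * (2 * (2 * I)))] at h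
    exact h.symm

/-! ### Translation to characteristics and conclusion -/

lemma theta_one_zero (τ : ℂ) : theta 1 0 0 τ = jacobiThetaHalf 0 τ := by
  rw [theta_one_left]
  simp

lemma theta_one_quarter (τ : ℂ) : theta 1 (1 / 4) 0 τ = jacobiThetaHalf (1 / 8) τ := by
  rw [theta_one_left]
  norm_num

lemma theta_one_three_quarters (τ : ℂ) : theta 1 (3 / 4) 0 τ = jacobiThetaHalf (3 / 8) τ := by
  rw [theta_one_left]
  norm_num

lemma thetaDeriv_one_left (ε : ℝ) {τ : ℂ} (hτ : 0 < τ.im) :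
    thetaDeriv 1 ε τ = jacobiThetaHalf' (ε / 2) τ := by
  have h := (hasDerivAt_jacobiThetaHalf (0 + ε / 2) hτ).comp_add_const 0 ((ε : ℂ) / 2)
  simp only [thetaDeriv, theta_one_left]
  rw [h.deriv, zero_add]

lemma thetaDeriv_one_quarter {τ : ℂ} (hτ : 0 < τ.im) :
    thetaDeriv 1 (1 / 4) τ = jacobiThetaHalf' (1 / 8) τ := by
  rw [thetaDeriv_one_left _ hτ]
  norm_num

lemma thetaDeriv_one_three_quarters {τ : ℂ} (hτ : 0 < τ.im) :
    thetaDeriv 1 (3 / 4) τ = jacobiThetaHalf' (3 / 8) τ := by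
  rw [thetaDeriv_one_left _ hτ]
  norm_num

theorem mainTheorem5 :
    (∃ τ : UpperHalfPlane, theta 1 (1 / 4) 0 τ ^ 4 + theta 1 (3 / 4) 0 τ ^ 4 ≠ 0) ∧
    ∀ τ : UpperHalfPlane,
      (theta 1 (1 / 4) 0 τ ^ 4 + theta 1 (3 / 4) 0 τ ^ 4) * thetaDeriv 1 (1 / 4) τ =
          -(Real.pi : ℂ) * theta 1 (1 / 4) 0 τ * theta 0 0 0 (4 * τ) *
            (theta 1 0 0 (2 * τ) ^ 2 * theta 0 1 0 (4 * τ) *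
                (theta 0 0 0 (4 * τ) ^ 2 + 3 * theta 1 0 0 (4 * τ) ^ 2) +
              2 * (Real.sqrt 2 : ℂ) * theta 1 (3 / 4) 0 τ ^ 4 * theta 0 0 0 (2 * τ)) ∧
      (theta 1 (1 / 4) 0 τ ^ 4 + theta 1 (3 / 4) 0 τ ^ 4) * thetaDeriv 1 (3 / 4) τ =
          (Real.pi : ℂ) * theta 1 (3 / 4) 0 τ * theta 0 0 0 (4 * τ) *
            (theta 1 0 0 (2 * τ) ^ 2 * theta 0 1 0 (4 * τ) *
                (theta 0 0 0 (4 * τ) ^ 2 + 3 * theta 1 0 0 (4 * τ) ^ 2) -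
              2 * (Real.sqrt 2 : ℂ) * theta 1 (1 / 4) 0 τ ^ 4 * theta 0 0 0 (2 * τ)) ∧
      (theta 1 (1 / 4) 0 τ ^ 4 + theta 1 (3 / 4) 0 τ ^ 4 ≠ 0 →
        thetaDeriv 1 (1 / 4) τ =
          (-(Real.pi : ℂ) * theta 1 (1 / 4) 0 τ * theta 0 0 0 (4 * τ)) /
              (theta 1 (1 / 4) 0 τ ^ 4 + theta 1 (3 / 4) 0 τ ^ 4) *
            (theta 1 0 0 (2 * τ) ^ 2 * theta 0 1 0 (4 * τ) *
                (theta 0 0 0 (4 * τ) ^ 2 + 3 * theta 1 0 0 (4 * τ) ^ 2) +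
              2 * (Real.sqrt 2 : ℂ) * theta 1 (3 / 4) 0 τ ^ 4 * theta 0 0 0 (2 * τ)) ∧
        thetaDeriv 1 (3 / 4) τ =
          ((Real.pi : ℂ) * theta 1 (3 / 4) 0 τ * theta 0 0 0 (4 * τ)) /
              (theta 1 (1 / 4) 0 τ ^ 4 + theta 1 (3 / 4) 0 τ ^ 4) *
            (theta 1 0 0 (2 * τ) ^ 2 * theta 0 1 0 (4 * τ) *
                (theta 0 0 0 (4 * τ) ^ 2 + 3 * theta 1 0 0 (4 * τ) ^ 2) -
              2 * (Real.sqrt 2 : ℂ) * theta 1 (1 / 4) 0 τ ^ 4 * theta 0 0 0 (2 * τ))) := by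

  refine ⟨?_, fun τ ↦ ?_⟩
  · simpa only [theta_one_quarter, theta_one_three_quarters] using
      exists_jacobiThetaHalf_eighths_pow_four_add_ne_zero
  have hτ : 0 < (τ : ℂ).im := τ.im_pos
  rw [thetaDeriv_one_quarter hτ, thetaDeriv_one_three_quarters hτ, theta_one_quarter,
    theta_one_three_quarters, theta_zero_zero, theta_zero_zero, theta_one_zero, theta_one_zero,
    theta_zero_one, jacobiThetaHalf'_eighth hτ, jacobiThetaHalf'_three_eighths hτ]
  have key := sqrt_two_mul_jacobiThetaHalf_eighths_pow_four_sub hτ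
  -- The identities multiplied by D are shared, since the quotient forms follow from them.
  refine (fun h1 h2 ↦ ⟨h1, h2, fun hD ↦ ⟨?_, ?_⟩⟩ : ∀ _ _, _) ?_ ?_
  · linear_combination (-Real.pi * jacobiThetaHalf (1 / 8) (τ : ℂ) * jacobiTheta₂ 0 (4 * τ)) * key
  · linear_combination (Real.pi * jacobiThetaHalf (3 / 8) (τ : ℂ) * jacobiTheta₂ 0 (4 * τ)) * key
  · rw [div_mul_eq_mul_div, eq_div_iff hD, mul_comm]
    exact h1
  · rw [div_mul_eq_mul_div, eq_div_iff hD, mul_comm]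
    exact h2
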